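/- Let $\mathfrak c=|\mathbb R|$, and let "perfect set" mean a nonempty closed subset of $\mathbb C$ without isolated points. Let $\mathcal G$ be the set of all functions $f:\mathbb C\to\mathbb C$ such that: (a) $f$ is strongly everywhere surjective, i.e. for every nonempty open $U\subset\mathbb C$ and every $z\in\mathbb C$ the set $\{x\in U: f(x)=z\}$ has cardinality $\mathfrak c$; (b) every perfect set $S\subset\mathbb C$ contains a perfect set $S'\subset S$ with $f|_{S'}=0$; (c) $f$ is Lebesgue measurable, and $f$ has the Baire property (the preimage of every open set differs from an open set by a meager set). Every function $f:\mathbb C\to\mathbb C$ satisfying (b), hence every $f\in\mathcal G$, is $s(\mathbb C)$-measurable, i.e. the preimage under $f$ of every Borel set belongs to the Marczewski $\sigma$-algebra $s(\mathbb C)$ of all $A\subset\mathbb C$ such that every perfect set $P$ contains a perfect set $Q$ with $Q\subset A\cap P$ or $Q\subset P\setminus A$. Moreover, $\mathcal G$ is strongly $2^{\mathfrak c}$-algebrable in the complex algebra $\mathbb C^{\mathbb C}$ of all functions $\mathbb C\to\mathbb C$ with pointwise operations: there is a set $X\subset\mathbb C^{\mathbb C}$ of cardinality $2^{\mathfrak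 c}$ such that $P(f_1,\dots,f_n)\neq 0$ for all $n\ge 1$, all distinct $f_1,\dots,f_n\in X$ and every nonzero complex polynomial $P$ in $n$ variables without constant term, and such that the (not necessarily unital) subalgebra generated by $X$ is contained in $\mathcal G\cup\{0\}$. -/

import Mathlib

open scoped Cardinal

/-- A set `X` in a commutative `𝕜`-algebra freely generates the (non-unital) algebra it generates:
no nonzero polynomial without constant term vanishes at distinct elements of `X`. -/
def FreelyGenerates (𝕜 : Type*) {A : Type*} [Field 𝕜] [CommRing A] [Algebra 𝕜 A]
    (X : Set A) : Prop :=
  ∀ P : MvPolynomial X 𝕜, MvPolynomial.constantCoeff P = 0 →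
    MvPolynomial.aeval (fun x : X => (x : A)) P = 0 → P = 0

/-- `E` is strongly `κ`-algebrable: `E ∪ {0}` contains a free (commutative, not necessarily
unital) algebra with `κ` free generators. -/
def StronglyAlgebrable (𝕜 : Type*) {A : Type*} [Field 𝕜] [CommRing A] [Algebra 𝕜 A]
    (κ : Cardinal) (E : Set A) : Prop :=
  ∃ X : Set A, #X = κ ∧ FreelyGenerates 𝕜 X ∧
    (NonUnitalAlgebra.adjoin 𝕜 X : Set A) ⊆ E ∪ {0}

/-- Every value is taken continuum many times on every nonempty open set. -/
def StronglyEverywhereSurjective (f : ℂ → ℂ) : Prop :=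
  ∀ U : Set ℂ, IsOpen U → U.Nonempty → ∀ z : ℂ, #{x : ℂ | x ∈ U ∧ f x = z} = 𝔠

/-- Every nonempty perfect set contains a nonempty perfect set on which `f` vanishes. -/
def VanishesPerfectly (f : ℂ → ℂ) : Prop :=
  ∀ S : Set ℂ, Perfect S → S.Nonempty →
    ∃ S' : Set ℂ, S' ⊆ S ∧ Perfect S' ∧ S'.Nonempty ∧ ∀ x ∈ S', f x = 0

/-- Membership in the Marczewski σ-algebra of a topological space. -/
def MarczewskiSet {X : Type*} [TopologicalSpace X] (A : Set X) : Prop :=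
  ∀ P : Set X, Perfect P → P.Nonempty →
    ∃ Q : Set X, Q ⊆ P ∧ Perfect Q ∧ Q.Nonempty ∧ (Q ⊆ A ∩ P ∨ Q ⊆ P \ A)

/-- Measurability with respect to the Marczewski σ-algebra: preimages of Borel sets
belong to it. -/
def MarczewskiMeasurable (f : ℂ → ℂ) : Prop :=
  ∀ B : Set ℂ, MeasurableSet B → MarczewskiSet (f ⁻¹' B)

/-- Preimages of open sets have the property of Baire. -/
def HasBaireProperty (f : ℂ → ℂ) : Prop :=
  ∀ U : Set ℂ, IsOpen U → BaireMeasurableSet (f ⁻¹' U)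

/-- The class `𝒢`. Being null-measurable for `volume` is Lebesgue measurability: preimages of
Borel sets are measurable for the completion of the Lebesgue measure on the Borel sets. -/
def classG : Set (ℂ → ℂ) :=
  {f | StronglyEverywhereSurjective f ∧ VanishesPerfectly f ∧
    MeasureTheory.NullMeasurable f MeasureTheory.volume ∧ HasBaireProperty f}

/-!
Every function of the algebra is a composite `φ ∘ L` of one labelling `L : ℂ → T` of the plane with
a function `φ : T → ℂ`. If `φ t₀ = 0` for some label `t₀`, and the points with another label
form a Marczewski null set on countably many vertical lines, then `φ ∘ L` vanishes on a
perfect subset of every perfect set, almost everywhere, and on a comeager set. If moreover every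
label occurs continuum many times in every nonempty open set, strong everywhere surjectivity only
asks that `φ` be surjective.

The labelled points come from a function between Cantor sets whose graph is Marczewski null;
countably many copies of the graph, embedded in distinct vertical lines, reach every open set. For
the functions `φ`, an independent family of `2 ^ 𝔠` functions on a set of `𝔠` labels takes
arbitrary values at finitely many indices simultaneously, so a nonconstant polynomial in its members
is surjective because it is surjective as a function on the affine space.
-/

open Set Function

theorem not_countable_range_of_injective_cantor {X : Type*} {f : (ℕ → Bool) → X}
    (hf : Injective f) : ¬ (range f).Countable := by
  have : Uncountable (ℕ → Bool) := by
    rw [← Cardinal.aleph0_lt_mk_iff]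
    simpa using Cardinal.aleph0_lt_continuum
  exact fun h => not_countable_univ (countable_of_injective_of_countable_image hf.injOn
    (image_univ ▸ h))

section MarczewskiNull

variable {X Y : Type*} [TopologicalSpace X] [TopologicalSpace Y]

/-- Marczewski null sets (the class `s₀`): every nonempty perfect set contains a nonempty perfect
set disjoint from `A`. They measure the smallness of the support of a function satisfying
`VanishesPerfectly`. -/
def MarczewskiNull (A : Set X) : Prop :=
  ∀ P : Set X, Perfect P → P.Nonempty → ∃ Q ⊆ P, Perfect Q ∧ Q.Nonempty ∧ Disjoint Q A

theorem MarczewskiNull.exists_perfect_disjoint_of_not_countable [SecondCountableTopology X]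
    {A C : Set X} (hA : MarczewskiNull A) (hC : IsClosed C) (hunc : ¬ C.Countable) :
    ∃ Q ⊆ C, Perfect Q ∧ Q.Nonempty ∧ Disjoint Q A := by
  obtain ⟨P, hP, hne, hPC⟩ := exists_perfect_nonempty_of_isClosed_of_not_countable hC hunc
  obtain ⟨Q, hQP, hQ⟩ := hA P hP hne
  exact ⟨Q, hQP.trans hPC, hQ⟩

theorem not_countable_of_perfect [PolishSpace X] {P : Set X} (hP : Perfect P)
    (hne : P.Nonempty) : ¬ P.Countable := by
  let := TopologicalSpace.upgradeIsCompletelyMetrizable X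
  obtain ⟨f, hfP, -, hf⟩ := hP.exists_nat_bool_injection hne
  exact fun h => not_countable_range_of_injective_cantor hf (h.mono hfP)

theorem exists_injection_cantor_prod_cantor [PolishSpace X] {C : Set X} (hC : IsClosed C)
    (hunc : ¬ C.Countable) :
    ∃ g : (ℕ → Bool) × (ℕ → Bool) → X, range g ⊆ C ∧ Continuous g ∧ Injective g := by
  let e : (ℕ → Bool) × (ℕ → Bool) ≃ₜ (ℕ → Bool) :=
    Homeomorph.sumArrowHomeomorphProdArrow.symm.trans
      (Homeomorph.piCongrLeft (Y := fun _ => Bool) Equiv.natSumNatEquivNat)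
  obtain ⟨f, hfC, hfc, hfi⟩ := hC.exists_nat_bool_injection_of_not_countable hunc
  exact ⟨f ∘ e, (range_comp_subset_range _ _).trans hfC, hfc.comp e.continuous,
    hfi.comp e.injective⟩

-- `C` contains continuum many disjoint Cantor sets, so one of them misses `A`.
theorem exists_perfect_disjoint_of_mk_inter_lt_continuum [PolishSpace X] {A C : Set X}
    (hC : IsClosed C) (hunc : ¬ C.Countable) (hA : #(C ∩ A : Set X) < 𝔠) :
    ∃ Q ⊆ C, Perfect Q ∧ Q.Nonempty ∧ Disjoint Q A := by
  obtain ⟨g, hgC, hgc, hgi⟩ := exists_injection_cantor_prod_cantor hC hunc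
  obtain ⟨a, ha⟩ : ∃ a, Disjoint (range fun b => g (a, b)) A := by
    by_contra! h
    have hmeet : ∀ a, ∃ b, g (a, b) ∈ A := fun a => by
      obtain ⟨_, ⟨b, rfl⟩, hb⟩ := not_disjoint_iff.1 (h a)
      exact ⟨b, hb⟩
    choose b hb using hmeet
    have hinj : Injective fun a => (⟨g (a, b a), hgC (mem_range_self _), hb a⟩ : ↥(C ∩ A)) :=
      fun a a' haa' => congrArg Prod.fst (hgi (congrArg Subtype.val haa'))
    refine hA.not_ge (Cardinal.lift_le.{0}.1 ?_)
    calc Cardinal.lift.{0} 𝔠 = Cardinal.lift.{_, 0} #(ℕ → Bool) := by simp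
      _ ≤ Cardinal.lift.{0} #↑(C ∩ A) := Cardinal.lift_mk_le_lift_mk_of_injective hinj
  have hslice : Injective fun b => g (a, b) := fun b b' h => congrArg Prod.snd (hgi h)
  have hclosed : IsClosed (range fun b => g (a, b)) := (isCompact_range (by fun_prop)).isClosed
  obtain ⟨Q, hQ, hQne, hQg⟩ :=
    exists_perfect_nonempty_of_isClosed_of_not_countable hclosed
      (not_countable_range_of_injective_cantor hslice)
  refine ⟨Q, hQg.trans ?_, hQ, hQne, ha.mono_left hQg⟩
  exact (range_comp_subset_range (Prod.mk a) g).trans hgC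

theorem exists_perfect_disjoint_of_countable_inter [PolishSpace X] {A P : Set X} (hP : Perfect P)
    (hne : P.Nonempty) (hA : (P ∩ A).Countable) : ∃ Q ⊆ P, Perfect Q ∧ Q.Nonempty ∧ Disjoint Q A :=
  exists_perfect_disjoint_of_mk_inter_lt_continuum hP.closed (not_countable_of_perfect hP hne)
    (hA.le_aleph0.trans_lt Cardinal.aleph0_lt_continuum)

theorem MarczewskiNull.mono {A B : Set X} (hB : MarczewskiNull B) (h : A ⊆ B) :
    MarczewskiNull A := fun P hP hne => by
  obtain ⟨Q, hQP, hQ, hQne, hQB⟩ := hB P hP hne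
  exact ⟨Q, hQP, hQ, hQne, hQB.mono_right h⟩

theorem MarczewskiNull.image [PolishSpace X] [PolishSpace Y] {A : Set X} (hA : MarczewskiNull A)
    {f : X → Y} (hf : Topology.IsClosedEmbedding f) : MarczewskiNull (f '' A) := by
  intro P hP hne
  by_cases hcount : (f ⁻¹' P).Countable
  · refine exists_perfect_disjoint_of_countable_inter hP hne ((hcount.image f).mono ?_)
    rintro _ ⟨hxP, x, -, rfl⟩
    exact mem_image_of_mem f hxP
  · obtain ⟨Q, hQP, hQ, hQne, hQA⟩ :=
      hA.exists_perfect_disjoint_of_not_countable (hP.closed.preimage hf.continuous) hcount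
    have hunc : ¬ (f '' Q).Countable := fun h => not_countable_of_perfect hQ hQne
      (countable_of_injective_of_countable_image hf.injective.injOn h)
    obtain ⟨R, hR, hRne, hRQ⟩ := exists_perfect_nonempty_of_isClosed_of_not_countable
      (hf.isClosedMap Q hQ.closed) hunc
    exact ⟨R, hRQ.trans (image_subset_iff.2 hQP), hR, hRne,
      ((disjoint_image_iff hf.injective).2 hQA).mono_left hRQ⟩

theorem MarczewskiNull.iUnion_of_pairwise_disjoint_isClosed [PolishSpace X] {ι : Type*}
    [Countable ι] {A C : ι → Set X} (hA : ∀ i, MarczewskiNull (A i)) (hC : ∀ i, IsClosed (C i))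
    (hdisj : Pairwise (Disjoint on C)) (hAC : ∀ i, A i ⊆ C i) : MarczewskiNull (⋃ i, A i) := by
  intro P hP hne
  by_cases hcount : ∀ i, (P ∩ C i).Countable
  · refine exists_perfect_disjoint_of_countable_inter hP hne ((countable_iUnion hcount).mono ?_)
    rw [inter_iUnion]
    exact iUnion_mono fun i => inter_subset_inter_right P (hAC i)
  · push Not at hcount
    obtain ⟨i, hi⟩ := hcount
    obtain ⟨Q, hQ, hQperf, hQne, hQA⟩ :=
      (hA i).exists_perfect_disjoint_of_not_countable (hP.closed.inter (hC i)) hi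
    refine ⟨Q, hQ.trans inter_subset_left, hQperf, hQne, disjoint_iUnion_right.2 fun j => ?_⟩
    obtain rfl | hij := eq_or_ne i j
    · exact hQA
    · exact (hdisj hij).mono (hQ.trans inter_subset_right) (hAC j)

end MarczewskiNull

section Graph

open TopologicalSpace

universe u

theorem mk_setOf_isClosed_le_continuum (X : Type u) [TopologicalSpace X]
    [SecondCountableTopology X] : #{C : Set X | IsClosed C} ≤ 𝔠 := by
  obtain ⟨b, hb, -, hbasis⟩ := exists_countable_basis X
  have hinj : Injective fun C : {C : Set X | IsClosed C} =>
      {V : b | (V : Set X) ⊆ (C : Set X)ᶜ} := by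
    intro C D hCD
    have hmem : ∀ V ∈ b, V ⊆ (C : Set X)ᶜ ↔ V ⊆ (D : Set X)ᶜ := fun V hV =>
      Set.ext_iff.1 hCD ⟨V, hV⟩
    refine Subtype.ext (compl_injective ?_)
    rw [hbasis.open_eq_sUnion' C.2.isOpen_compl, hbasis.open_eq_sUnion' D.2.isOpen_compl]
    exact congrArg sUnion (Set.ext fun V => and_congr_right (hmem V))
  calc #{C : Set X | IsClosed C} ≤ #(Set b) := Cardinal.mk_le_of_injective hinj
    _ = 2 ^ #b := Cardinal.mk_set
    _ ≤ 2 ^ Cardinal.aleph0 := Cardinal.power_le_power_left two_ne_zero hb.le_aleph0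
    _ = 𝔠 := Cardinal.two_power_aleph0

theorem mk_le_continuum_of_secondCountable (X : Type u) [TopologicalSpace X] [T1Space X]
    [SecondCountableTopology X] : #X ≤ 𝔠 :=
  (Cardinal.mk_le_of_injective
    (f := fun x => (⟨{x}, isClosed_singleton⟩ : {C : Set X | IsClosed C}))
    fun _ _ h => singleton_injective (congrArg Subtype.val h)).trans
  (mk_setOf_isClosed_le_continuum X)

theorem exists_notMem_iUnion_of_countable {ι Y : Type u} (hY : 𝔠 ≤ #Y) (hι : #ι < 𝔠)
    {S : ι → Set Y} (hS : ∀ i, (S i).Countable) : ∃ y, y ∉ ⋃ i, S i := by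
  have hlt : #(⋃ i, S i) < 𝔠 := (Cardinal.mk_iUnion_le S).trans_lt <|
    Cardinal.mul_lt_of_lt Cardinal.aleph0_le_continuum hι <|
      (ciSup_le' fun i => (hS i).le_aleph0).trans_lt Cardinal.aleph0_lt_continuum
  by_contra! h
  rw [eq_univ_of_forall h, Cardinal.mk_univ] at hlt
  exact hlt.not_ge hY

theorem exists_perfect_disjoint_range_graph {X Y : Type*} [TopologicalSpace X] [PolishSpace X]
    [TopologicalSpace Y] [PolishSpace Y] {C : Set (X × Y)} (hC : IsClosed C) {x : X}
    (hx : ¬ {y | (x, y) ∈ C}.Countable) (h : X → Y) :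
    ∃ Q ⊆ C, Perfect Q ∧ Q.Nonempty ∧ Disjoint Q (range fun x => (x, h x)) := by
  have hline : IsClosed (C ∩ Prod.fst ⁻¹' {x}) :=
    hC.inter (isClosed_singleton.preimage continuous_fst)
  have hunc : ¬ (C ∩ Prod.fst ⁻¹' {x}).Countable := by
    refine fun hcount => hx ((hcount.image Prod.snd).mono fun y hy => ?_)
    exact ⟨(x, y), ⟨hy, rfl⟩, rfl⟩
  have hsub : (C ∩ Prod.fst ⁻¹' {x} ∩ range fun x => (x, h x)).Subsingleton := by
    rintro _ ⟨⟨-, rfl⟩, x, rfl⟩ _ ⟨⟨-, rfl⟩, x', rfl⟩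
    rfl
  obtain ⟨Q, hQ, hQ'⟩ := exists_perfect_disjoint_of_mk_inter_lt_continuum hline hunc
    (hsub.countable.le_aleph0.trans_lt Cardinal.aleph0_lt_continuum)
  exact ⟨Q, hQ.trans inter_subset_left, hQ'⟩

-- Well-order the points and the closed sets in type `𝔠`, and let the graph over `x` avoid the
-- countable sections of the closed sets before `x`. A closed set with only countable sections then
-- meets the graph over an initial segment only; any other one has an uncountable section, where
-- the graph has a single point.
theorem exists_marczewskiNull_range_graph (X Y : Type u) [TopologicalSpace X] [PolishSpace X]
    [TopologicalSpace Y] [PolishSpace Y] (hY : 𝔠 ≤ #Y) :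
    ∃ h : X → Y, MarczewskiNull (range fun x => (x, h x)) := by
  let ι : Type u := (𝔠 : Cardinal.{u}).ord.ToType
  have hι : #ι = 𝔠 := Cardinal.mk_ord_toType 𝔠
  have hIio (i : ι) : #(Iio i) < 𝔠 := (Cardinal.mk_Iio_lt i (by simp [ι])).trans_eq hι
  have hIic (i : ι) : #(Iic i) < 𝔠 :=
    (Cardinal.mk_Iic_lt i (by simp [ι]) (hι ▸ Cardinal.aleph0_le_continuum)).trans_eq hι
  obtain ⟨a⟩ : Nonempty (X ↪ ι) := by
    rw [← Cardinal.le_def, hι]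
    exact mk_le_continuum_of_secondCountable X
  obtain ⟨c⟩ : Nonempty ({C : Set (X × Y) | IsClosed C} ↪ ι) := by
    rw [← Cardinal.le_def, hι]
    exact mk_setOf_isClosed_le_continuum (X × Y)
  have havoid (x : X) : ∃ y, y ∉ ⋃ C : {C // c C < a x ∧ {y | (x, y) ∈ C.1}.Countable},
      {y | (x, y) ∈ C.1.1} := by
    refine exists_notMem_iUnion_of_countable hY (lt_of_le_of_lt ?_ (hIio (a x))) fun C => C.2.2
    exact Cardinal.mk_le_of_injective (f := fun C => (⟨c C.1, C.2.1⟩ : Iio (a x)))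
      fun C D h => Subtype.ext (c.injective (congrArg Subtype.val h))
  choose h hh using havoid
  refine ⟨h, fun P hP hne => ?_⟩
  by_cases hsections : ∀ x, {y | (x, y) ∈ P}.Countable
  · refine exists_perfect_disjoint_of_mk_inter_lt_continuum hP.closed
      (not_countable_of_perfect hP hne) (lt_of_le_of_lt ?_ (hIic (c ⟨P, hP.closed⟩)))
    refine Cardinal.mk_le_of_injective (f := fun p : ↥(P ∩ range fun x => (x, h x)) =>
      (⟨a p.1.1, ?_⟩ : Iic (c ⟨P, hP.closed⟩))) ?_
    · obtain ⟨_, hxP, x, rfl⟩ := p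
      refine mem_Iic.2 (not_lt.1 fun hlt => hh x (mem_iUnion.2
        ⟨⟨⟨P, hP.closed⟩, hlt, hsections x⟩, hxP⟩))
    · rintro ⟨_, _, x, rfl⟩ ⟨_, _, x', rfl⟩ hxx'
      obtain rfl : x = x' := a.injective (congrArg Subtype.val hxx')
      rfl
  · push Not at hsections
    obtain ⟨x, hx⟩ := hsections
    exact exists_perfect_disjoint_range_graph hP.closed hx h

end Graph

section ThinLabelling

open TopologicalSpace

universe u

theorem exists_injective_forall_mem_of_infinite {ι α : Type*} [Countable ι] {S : ι → Set α}
    (hS : ∀ i, (S i).Infinite) : ∃ r : ι → α, Injective r ∧ ∀ i, r i ∈ S i := by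
  classical
  obtain ⟨e, he⟩ := exists_injective_nat ι
  choose t htS htcard using fun i => (hS i).exists_subset_card_eq (e i + 1)
  have hall (s : Finset ι) : s.card ≤ (s.biUnion t).card := by
    obtain rfl | hs := s.eq_empty_or_nonempty
    · simp
    obtain ⟨i, hi, hmax⟩ := s.exists_max_image e hs
    calc s.card = (s.image e).card := (Finset.card_image_of_injective s he).symm
      _ ≤ (Finset.range (e i + 1)).card := Finset.card_le_card <| Finset.image_subset_iff.2
          fun j hj => Finset.mem_range_succ_iff.2 (hmax j hj)
      _ = (t i).card := by rw [Finset.card_range, htcard]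
      _ ≤ (s.biUnion t).card := Finset.card_le_card (Finset.subset_biUnion_of_mem t hi)
  obtain ⟨r, hr, hrt⟩ := (Finset.all_card_le_biUnion_card_iff_exists_injective t).1 hall
  exact ⟨r, hr, fun i => htS i (hrt i)⟩

theorem exists_mk_preimage_singleton_eq {X T : Type u} [Infinite X] [Nonempty T]
    (hT : #T ≤ #X) : ∃ l : X → T, ∀ t, #(l ⁻¹' {t}) = #X := by
  obtain ⟨e⟩ : Nonempty (X ≃ T × X) := by
    rw [← Cardinal.eq, Cardinal.mk_prod, Cardinal.lift_id, Cardinal.lift_id,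
      Cardinal.mul_eq_right (Cardinal.aleph0_le_mk X) hT (Cardinal.mk_ne_zero T)]
  refine ⟨Prod.fst ∘ e, fun t => (Cardinal.mk_set_le _).antisymm ?_⟩
  exact Cardinal.mk_le_of_injective (f := fun x => ⟨e.symm (t, x), by simp⟩)
    fun x x' h => congrArg Prod.snd (e.symm.injective (congrArg Subtype.val h))

theorem exists_injection_cantor_prod_cantor_inter_re {U : Set ℂ} (hU : IsOpen U) {x : ℝ}
    (hx : x ∈ Complex.re '' U) :
    ∃ g : (ℕ → Bool) × (ℕ → Bool) → ℂ, range g ⊆ U ∩ Complex.re ⁻¹' {x} ∧ Continuous g ∧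
      Injective g := by
  obtain ⟨z, hz, rfl⟩ := hx
  obtain ⟨ε, hε, hball⟩ := Metric.nhds_basis_closedBall.mem_iff.1 (hU.mem_nhds hz)
  have hclosed : IsClosed (Metric.closedBall z ε ∩ Complex.re ⁻¹' {z.re}) :=
    Metric.isClosed_closedBall.inter (isClosed_singleton.preimage Complex.continuous_re)
  have hseg : MapsTo (fun t : ℝ => z + t * Complex.I) (Icc 0 ε)
      (Metric.closedBall z ε ∩ Complex.re ⁻¹' {z.re}) := fun t ht => by
    simpa [abs_of_nonneg ht.1] using ht.2
  have hunc : ¬ (Metric.closedBall z ε ∩ Complex.re ⁻¹' {z.re}).Countable := fun hcount => by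
    have hinj : Injective fun t : ℝ => z + t * Complex.I := fun s t hst => by simpa using hst
    have := countable_of_injective_of_countable_image hinj.injOn (hcount.mono hseg.image_subset)
    exact hε.not_ge (Cardinal.Real.Icc_countable_iff.1 this)
  obtain ⟨g, hg, hgc, hgi⟩ := exists_injection_cantor_prod_cantor hclosed hunc
  exact ⟨g, hg.trans (inter_subset_inter_left _ hball), hgc, hgi⟩

/-- A labelling of the plane in which every label occurs continuum many times in every nonempty
open set, although the points whose label is not `t₀` form a Marczewski null set that lies on
countably many vertical lines. The functions of the algebra depend on the label only, and vanish at
`t₀`. -/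
structure IsThinLabelling {T : Type*} (t₀ : T) (L : ℂ → T) : Prop where
  mk_inter_preimage : ∀ U : Set ℂ, IsOpen U → U.Nonempty → ∀ t, #{x | x ∈ U ∧ L x = t} = 𝔠
  marczewskiNull : MarczewskiNull {x | L x ≠ t₀}
  countable_re : (Complex.re '' {x | L x ≠ t₀}).Countable

theorem exists_cantor_prod_cantor_on_distinct_lines :
    ∃ (r : countableBasis ℂ → ℝ) (ψ : countableBasis ℂ → (ℕ → Bool) × (ℕ → Bool) → ℂ),
      Injective r ∧ (∀ V, Topology.IsClosedEmbedding (ψ V)) ∧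
        ∀ V p, ψ V p ∈ V.1 ∧ (ψ V p).re = r V := by
  have hopen (V : countableBasis ℂ) : IsOpen V.1 := isOpen_of_mem_countableBasis V.2
  have hinf (V : countableBasis ℂ) : (Complex.re '' V.1).Infinite := by
    obtain ⟨x, hx⟩ := (nonempty_of_mem_countableBasis V.2).image Complex.re
    exact infinite_of_mem_nhds x ((Complex.isOpenMap_re _ (hopen V)).mem_nhds hx)
  obtain ⟨r, hr, hrV⟩ := exists_injective_forall_mem_of_infinite hinf
  choose ψ hψ hψc hψi using fun V =>
    exists_injection_cantor_prod_cantor_inter_re (hopen V) (hrV V)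
  exact ⟨r, ψ, hr, fun V => (hψc V).isClosedEmbedding (hψi V), fun V p => hψ V (mem_range_self p)⟩

-- Over each basic open set, embed the square of the Cantor set into a vertical line and restrict
-- the embedding to a Marczewski null graph.
theorem exists_injective_marczewskiNull_range :
    ∃ z : countableBasis ℂ × (ℕ → Bool) → ℂ, Injective z ∧ (∀ p, z p ∈ p.1.1) ∧
      MarczewskiNull (range z) ∧ (Complex.re '' range z).Countable := by
  obtain ⟨r, ψ, hr, hψ, hψV⟩ := exists_cantor_prod_cantor_on_distinct_lines
  have : PolishSpace (ℕ → Bool) := {}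
  obtain ⟨h, hh⟩ := exists_marczewskiNull_range_graph (ℕ → Bool) (ℕ → Bool) (by simp)
  have hline {V V' : countableBasis ℂ} {p p' : (ℕ → Bool) × (ℕ → Bool)}
      (heq : ψ V p = ψ V' p') : V = V' :=
    hr (by rw [← (hψV V p).2, heq, (hψV V' p').2])
  refine ⟨fun p => ψ p.1 (p.2, h p.2), fun ⟨V, k⟩ ⟨V', k'⟩ heq => ?_, fun p => (hψV _ _).1, ?_, ?_⟩
  · obtain rfl := hline heq
    exact congrArg (V, ·) (congrArg Prod.fst ((hψ V).injective heq))
  · have hrange : range (fun p : countableBasis ℂ × (ℕ → Bool) => ψ p.1 (p.2, h p.2)) =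
        ⋃ V, ψ V '' range fun k => (k, h k) := by
      ext x
      simp
    rw [hrange]
    refine .iUnion_of_pairwise_disjoint_isClosed (fun V => hh.image (hψ V))
      (fun V => (hψ V).isClosed_range) (fun V V' hne => ?_) fun V => image_subset_range _ _
    rw [onFun, disjoint_iff_forall_ne]
    rintro _ ⟨p, rfl⟩ _ ⟨p', rfl⟩ heq
    exact hne (hline heq)
  · refine (countable_range r).mono ?_
    rintro _ ⟨_, ⟨p, rfl⟩, rfl⟩
    exact ⟨p.1, (hψV _ _).2.symm⟩

theorem exists_isThinLabelling {T : Type} (t₀ : T) (hT : #T ≤ 𝔠) :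
    ∃ L : ℂ → T, IsThinLabelling t₀ L := by
  have hK : #(ℕ → Bool) = 𝔠 := by simp
  obtain ⟨z, hz, hzV, hnull, hre⟩ := exists_injective_marczewskiNull_range
  have : Nonempty T := ⟨t₀⟩
  obtain ⟨l, hl⟩ := exists_mk_preimage_singleton_eq (X := ℕ → Bool) (hT.trans_eq hK.symm)
  let L : ℂ → T := extend z (l ∘ Prod.snd) fun _ => t₀
  have hsupp : {x | L x ≠ t₀} ⊆ range z := fun x hx => by
    by_contra hxz
    exact hx (extend_apply' _ _ _ hxz)
  refine ⟨L, fun U hU ⟨x, hx⟩ t => ?_, hnull.mono hsupp, hre.mono (image_mono hsupp)⟩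
  refine ((Cardinal.mk_set_le _).trans_eq Cardinal.mk_complex).antisymm ?_
  obtain ⟨V, hV, -, hVU⟩ := (isBasis_countableBasis ℂ).exists_subset_of_mem_open hx hU
  have hmem (k : l ⁻¹' {t}) : z (⟨V, hV⟩, k) ∈ U ∧ L (z (⟨V, hV⟩, k)) = t :=
    ⟨hVU (hzV (⟨V, hV⟩, k)), (hz.extend_apply _ _ _).trans k.2⟩
  rw [← hK, ← hl t]
  exact Cardinal.mk_le_of_injective (f := fun k => ⟨z (⟨V, hV⟩, k), hmem k⟩) fun k k' hkk =>
    Subtype.ext (congrArg Prod.snd (hz (congrArg Subtype.val hkk)))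

end ThinLabelling

section ClassG

theorem MarczewskiNull.vanishesPerfectly {f : ℂ → ℂ} (hf : MarczewskiNull {x | f x ≠ 0}) :
    VanishesPerfectly f := fun S hS hne => by
  obtain ⟨Q, hQS, hQ, hQne, hQf⟩ := hf S hS hne
  exact ⟨Q, hQS, hQ, hQne, fun x hx => not_not.1 (disjoint_left.1 hQf hx)⟩

theorem VanishesPerfectly.marczewskiSet_preimage {f : ℂ → ℂ} (hf : VanishesPerfectly f)
    (B : Set ℂ) : MarczewskiSet (f ⁻¹' B) := fun P hP hne => by
  obtain ⟨Q, hQP, hQ, hQne, hQf⟩ := hf P hP hne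
  refine ⟨Q, hQP, hQ, hQne, ?_⟩
  by_cases h0 : (0 : ℂ) ∈ B
  · exact Or.inl fun x hx => ⟨by rwa [mem_preimage, hQf x hx], hQP hx⟩
  · exact Or.inr fun x hx => ⟨hQP hx, by rwa [mem_preimage, hQf x hx]⟩

theorem StronglyEverywhereSurjective.ne_zero {f : ℂ → ℂ} (hf : StronglyEverywhereSurjective f) :
    f ≠ 0 := by
  rintro rfl
  have := hf univ isOpen_univ univ_nonempty 1
  simp [Cardinal.continuum_ne_zero.symm] at this

theorem quasiMeasurePreserving_re :
    MeasureTheory.Measure.QuasiMeasurePreserving Complex.re MeasureTheory.volume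
      MeasureTheory.volume :=
  MeasureTheory.Measure.quasiMeasurePreserving_fst.comp
    Complex.volume_preserving_equiv_real_prod.quasiMeasurePreserving

theorem ae_eq_zero_of_countable_re_image {E : Type*} [Zero E] {f : ℂ → E}
    (hf : (Complex.re '' {x | f x ≠ 0}).Countable) : f =ᵐ[MeasureTheory.volume] 0 := by
  filter_upwards [quasiMeasurePreserving_re.ae (hf.ae_notMem MeasureTheory.volume)] with x hx
  exact not_not.1 fun h => hx (mem_image_of_mem _ h)

theorem residual_eq_zero_of_countable_re_image {E : Type*} [Zero E] {f : ℂ → E}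
    (hf : (Complex.re '' {x | f x ≠ 0}).Countable) : f =ᶠ[residual ℂ] 0 := by
  have hres := residual_of_dense_Gδ hf.isGδ_compl (hf.dense_compl ℝ)
  filter_upwards [tendsto_residual_of_isOpenMap Complex.continuous_re Complex.isOpenMap_re hres]
    with x hx
  exact not_not.1 fun h => hx (mem_image_of_mem _ h)

theorem hasBaireProperty_of_residualEq_continuous {f g : ℂ → ℂ} (hg : Continuous g)
    (hfg : f =ᶠ[residual ℂ] g) : HasBaireProperty f := fun U hU =>
  (hU.preimage hg).baireMeasurableSet.congr (hfg.symm.preimage U)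

theorem IsThinLabelling.comp_mem_classG {T : Type*} {t₀ : T} {L : ℂ → T}
    (hL : IsThinLabelling t₀ L) {φ : T → ℂ} (hφ : Surjective φ) (h0 : φ t₀ = 0) :
    φ ∘ L ∈ classG := by
  have hsupp : {x | (φ ∘ L) x ≠ 0} ⊆ {x | L x ≠ t₀} := fun x hx h =>
    hx ((congrArg φ h).trans h0)
  have hre := hL.countable_re.mono (image_mono hsupp)
  refine ⟨fun U hU hne z => ?_, (hL.marczewskiNull.mono hsupp).vanishesPerfectly,
    (aemeasurable_zero.congr (ae_eq_zero_of_countable_re_image hre).symm).nullMeasurable,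
    hasBaireProperty_of_residualEq_continuous continuous_zero
      (residual_eq_zero_of_countable_re_image hre)⟩
  obtain ⟨t, rfl⟩ := hφ z
  refine ((Cardinal.mk_set_le _).trans_eq Cardinal.mk_complex).antisymm ?_
  rw [← hL.mk_inter_preimage U hU hne t]
  exact Cardinal.mk_le_mk_of_subset fun x hx => ⟨hx.1, congrArg φ hx.2⟩

end ClassG

section Algebra

open MvPolynomial

universe u

-- A nonconstant polynomial restricts to a nonconstant univariate one on some line through `0`.
theorem surjective_eval_of_forall_ne_C {K σ : Type*} [Field K] [IsAlgClosed K]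
    {P : MvPolynomial σ K} (hP : ∀ c, P ≠ C c) : Surjective fun a => eval a P := fun v => by
  have : Infinite K := IsAlgClosed.instInfinite
  obtain ⟨a, ha⟩ : ∃ a, eval a P ≠ eval 0 P := by
    by_contra! h
    exact hP (eval 0 P) (MvPolynomial.funext fun a => by rw [h a, eval_C])
  let q : Polynomial K := aeval (fun i => Polynomial.C (a i) * Polynomial.X) P
  have hq (s : K) : q.eval s = eval (fun i => a i * s) P :=
    (comp_aeval_apply _ (Polynomial.aeval s) P).trans (by simp)
  have hdeg : (q - Polynomial.C v).degree ≠ 0 := fun h => ha <| by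
    have h01 : (q - Polynomial.C v).eval 1 = (q - Polynomial.C v).eval 0 := by
      rw [Polynomial.eq_C_of_degree_eq_zero h, Polynomial.eval_C, Polynomial.eval_C]
    simpa [hq, Pi.zero_def] using h01
  obtain ⟨s, hs⟩ := IsAlgClosed.exists_root _ hdeg
  exact ⟨fun i => a i * s, (hq s).symm.trans (by simpa [sub_eq_zero] using hs)⟩

open Classical in
theorem exists_finset_injOn_filter_mem {α : Type*} (s : Finset (Set α)) :
    ∃ F : Finset α, InjOn (fun A => F.filter (· ∈ A)) (s : Set (Set α)) := by
  have hsep (p : Set α × Set α) (hp : p.1 ≠ p.2) : ∃ x, ¬ (x ∈ p.1 ↔ x ∈ p.2) := by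
    by_contra! h
    exact hp (Set.ext h)
  choose x hx using hsep
  refine ⟨s.offDiag.attach.image
    fun p : {p // p ∈ s.offDiag} => x p.1 (Finset.mem_offDiag.1 p.2).2.2, fun A hA B hB hAB => ?_⟩
  by_contra hne
  refine hx (A, B) hne ?_
  have hmem : (A, B) ∈ s.offDiag := Finset.mem_offDiag.2 ⟨hA, hB, hne⟩
  have := Finset.ext_iff.1 hAB (x (A, B) hne)
  simp only [Finset.mem_filter] at this
  exact (and_congr_right_iff.1 this) (Finset.mem_image_of_mem _ (Finset.mem_attach _ ⟨_, hmem⟩))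

/-- The common domain of the functions in the independent family indexed by the subsets of `α`: a
finite set of test points, whose traces tell apart finitely many subsets of `α`, together with a
finitely supported table of values at traces. -/
abbrev TraceTable (α K : Type*) [Zero K] : Type _ :=
  Finset α × (Finset α →₀ K)

open Classical in
/-- An independent family of functions in the sense of Fichtenholz, Kantorovich and Hausdorff: the
function of index `A` looks up the value of the table at the trace of `A`. -/
noncomputable def independentFamily {α K : Type*} [Zero K] (A : Set α) (t : TraceTable α K) : K :=
  t.2 (t.1.filter (· ∈ A))

theorem exists_forall_independentFamily_eq {α K : Type*} [AddCommMonoid K]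
    (s : Finset (Set α)) (a : Set α → K) :
    ∃ t : TraceTable α K, ∀ A ∈ s, independentFamily A t = a A := by
  classical
  obtain ⟨F, hF⟩ := exists_finset_injOn_filter_mem s
  refine ⟨(F, ∑ A ∈ s, Finsupp.single (F.filter (· ∈ A)) (a A)), fun A hA => ?_⟩
  have hne (B) (hB : B ∈ s) (hBA : B ≠ A) : F.filter (· ∈ A) ≠ F.filter (· ∈ B) := fun h =>
    hBA (hF hB hA h.symm)
  rw [independentFamily, Finsupp.finsetSum_apply, Finset.sum_eq_single_of_mem A hA
    fun B hB hBA => Finsupp.single_eq_of_ne (hne B hB hBA), Finsupp.single_eq_same]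

theorem surjective_eval_independentFamily {α K : Type*} [Field K] [IsAlgClosed K]
    {P : MvPolynomial (Set α) K} (hP : ∀ c, P ≠ C c) :
    Surjective fun t : TraceTable α K => eval (fun A => independentFamily A t) P := fun v => by
  obtain ⟨a, rfl⟩ := surjective_eval_of_forall_ne_C hP v
  obtain ⟨t, ht⟩ := exists_forall_independentFamily_eq P.vars a
  exact ⟨t, eval₂Hom_congr' rfl (fun A hA _ => ht A hA) rfl⟩

theorem aeval_fun_comp_right {σ S T R : Type*} [CommSemiring R] (G : σ → T → R) (L : S → T)
    (P : MvPolynomial σ R) :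
    aeval (fun i => G i ∘ L) P = (fun t => eval (fun i => G i t) P) ∘ L :=
  _root_.funext fun x => comp_aeval_apply _ (Pi.evalAlgHom R (fun _ => R) x) P

theorem exists_aeval_eq_of_mem_adjoin_range {R A σ : Type*} [CommSemiring R] [CommSemiring A]
    [Algebra R A] {F : σ → A} {x : A} (hx : x ∈ NonUnitalAlgebra.adjoin R (range F)) :
    ∃ P : MvPolynomial σ R, constantCoeff P = 0 ∧ aeval F P = x := by
  induction hx using NonUnitalAlgebra.adjoin_induction with
  | mem x hx =>
    obtain ⟨i, rfl⟩ := hx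
    exact ⟨X i, by simp, by simp⟩
  | add x y _ _ hx hy =>
    obtain ⟨P, hP, rfl⟩ := hx
    obtain ⟨Q, hQ, rfl⟩ := hy
    exact ⟨P + Q, by simp [hP, hQ], by simp⟩
  | zero => exact ⟨0, by simp, by simp⟩
  | mul x y _ _ hx hy =>
    obtain ⟨P, hP, rfl⟩ := hx
    obtain ⟨Q, -, rfl⟩ := hy
    exact ⟨P * Q, by simp [hP], by simp⟩
  | smul r x _ hx =>
    obtain ⟨P, hP, rfl⟩ := hx
    exact ⟨r • P, by simp [hP], by simp⟩

theorem injective_of_forall_aeval_ne_zero {R A σ : Type*} [CommRing R] [Nontrivial R] [CommRing A]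
    [Algebra R A] {F : σ → A}
    (hF : ∀ P : MvPolynomial σ R, constantCoeff P = 0 → P ≠ 0 → aeval F P ≠ 0) :
    Injective F := fun i j hij => by
  by_contra hne
  have hX : (X i - X j : MvPolynomial σ R) ≠ 0 := sub_ne_zero.2 fun h => hne (X_injective h)
  exact hF _ (by simp) hX (by simp [hij])

theorem freelyGenerates_range_of_forall_aeval_ne_zero {𝕜 A σ : Type*} [Field 𝕜] [CommRing A]
    [Algebra 𝕜 A] {F : σ → A}
    (hF : ∀ P : MvPolynomial σ 𝕜, constantCoeff P = 0 → P ≠ 0 → aeval F P ≠ 0) :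
    FreelyGenerates 𝕜 (range F) := fun P hP0 hP => by
  let e : σ ≃ range F := Equiv.ofInjective F (injective_of_forall_aeval_ne_zero hF)
  have hFe : F ∘ e.symm = Subtype.val :=
    _root_.funext fun x => congrArg Subtype.val (e.apply_symm_apply x)
  have hren : rename e.symm P = 0 := by
    by_contra hne
    exact hF _ (by simpa using hP0) hne (by rwa [aeval_rename, hFe])
  exact rename_injective _ e.symm.injective (by rw [hren, map_zero])

theorem stronglyAlgebrable_of_forall_aeval_mem {𝕜 : Type*} {A σ : Type u} [Field 𝕜] [CommRing A]
    [Algebra 𝕜 A] {F : σ → A} {E : Set A} (hE : (0 : A) ∉ E)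
    (hF : ∀ P : MvPolynomial σ 𝕜, constantCoeff P = 0 → P ≠ 0 → aeval F P ∈ E) :
    StronglyAlgebrable 𝕜 #σ E := by
  have hne (P : MvPolynomial σ 𝕜) (hP0 : constantCoeff P = 0) (hP : P ≠ 0) : aeval F P ≠ 0 :=
    ne_of_mem_of_not_mem (hF P hP0 hP) hE
  refine ⟨range F, Cardinal.mk_range_eq F (injective_of_forall_aeval_ne_zero hne),
    freelyGenerates_range_of_forall_aeval_ne_zero hne, fun x hx => ?_⟩
  obtain ⟨P, hP0, rfl⟩ := exists_aeval_eq_of_mem_adjoin_range hx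
  obtain rfl | hP := eq_or_ne P 0
  · exact Or.inr (map_zero _)
  · exact Or.inl (hF P hP0 hP)

end Algebra

theorem mainTheorem8 :
    (∀ f : ℂ → ℂ, VanishesPerfectly f → MarczewskiMeasurable f) ∧
      StronglyAlgebrable ℂ ((2 : Cardinal.{0}) ^ Cardinal.continuum.{0}) classG := by
  refine ⟨fun f hf B _ => hf.marczewskiSet_preimage B, ?_⟩
  have hlabels : #(TraceTable ℝ ℂ) = 𝔠 := by simp [Cardinal.mk_prod, Cardinal.mk_real]
  obtain ⟨L, hL⟩ := exists_isThinLabelling ((∅, 0) : TraceTable ℝ ℂ) hlabels.le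
  rw [← Cardinal.mk_real, ← Cardinal.mk_set]
  refine stronglyAlgebrable_of_forall_aeval_mem (F := fun A => independentFamily A ∘ L)
    (fun h => h.1.ne_zero rfl) fun P hP0 hP => ?_
  have hPC (c : ℂ) : P ≠ MvPolynomial.C c := by
    rintro rfl
    exact hP (by simpa using hP0)
  rw [aeval_fun_comp_right]
  refine hL.comp_mem_classG (surjective_eval_independentFamily hPC) ?_
  simpa [independentFamily] using hP0
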